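/- Let $p$ be an odd prime and let $e\ge 1$ be an integer. Let $\phi$ be Euler's function, and put $$A=p^{\lfloor e/2\rfloor}-1,\qquad B=p^{\lfloor e/3\rfloor+\lfloor (e+1)/3\rfloor}-p^{\lfloor e/2\rfloor}.$$ (i) Let $n\ge 1$ be an integer with $p\nmid n$. For $d\ge 1$ let $N_{z^n-1}(d)$ be the number of residues $z$ modulo $d$ with $z^n-1\equiv 0 \pmod d$, and let $\mathcal N_{n(z^n+1)}(d)$ be the number of residues $z$ modulo $d$, relatively prime to $d$, with $n(z^n+1)\equiv 0\pmod d$. Then the number of pairs of integers $(x,y)$ with $1\le x,y\le p^e(p-1)$, $p\nmid x$, $p\nmid y$, and $$x^{x^n}\equiv y \pmod{p^e},\qquad y^{y^n}\equiv x\pmod{p^e}$$ is equal to $$\sum_{x_0=1}^{p-1}\sum_{y_0=1}^{p-1}\gcd(p-1,\,x_0^ny_0^n-1)\;+\;\sum_{x_0=1}^{p-1}\sum_{y_0=1}^{p-1}\gcd\bigl(p-1,\,n(y_0^n+1),\,x_0^ny_0^n-1\bigr)\cdot A$$ $$+\;\sum_{x_0=1}^{p-1}\sum_{y_0=1}^{p-1}\bigl(\gcd(p-1,\,2n,\,x_0^ny_0^n-1)-\gcd(p-1,\,n,\,x_0^ny_0^n-1)\bigr)\cdot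 B,$$ and it is also equal to $$\sum_{d\mid p-1}\phi(d)^2\Bigl(\frac{p-1}{d}\Bigr)^2N_{z^n-1}(d)\;+\;\sum_{d\mid p-1}\phi(d)\Bigl(\frac{p-1}{d}\Bigr)^2\mathcal N_{n(z^n+1)}(d)\,N_{z^n-1}(d)\cdot A$$ $$+\sum_{\substack{d\mid \gcd(p-1,2n)\\ d\nmid\gcd(p-1,n)}}\phi(d)^2\Bigl(\frac{p-1}{d}\Bigr)^2N_{z^n-1}(d)\cdot B .$$ (ii) In particular, the number of pairs of integers $(x,y)$ with $1\le x,y\le p^e(p-1)$, $p\nmid x$, $p\nmid y$, and $$x^{x}\equiv y \pmod{p^e},\qquad y^{y}\equiv x\pmod{p^e}$$ is equal to $$\sum_{x_0=1}^{p-1}\sum_{y_0=1}^{p-1}\gcd(p-1,\,x_0y_0-1)+\sum_{x_0=1}^{p-1}\sum_{y_0=1}^{p-1}\gcd(p-1,\,y_0+1,\,x_0y_0-1)\cdot A+\sum_{x_0=1}^{p-1}\sum_{y_0=1}^{p-1}\bigl(\gcd(2,\,x_0y_0-1)-1\bigr)\cdot B,$$ and it is also equal to $$\sum_{d\mid p-1}\phi(d)^2\Bigl(\frac{p-1}{d}\Bigr)^2+\sum_{d\mid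 p-1}\phi(d)\Bigl(\frac{p-1}{d}\Bigr)^2\cdot A+\Bigl(\frac{p-1}{2}\Bigr)^2\cdot B .$$ -/

import Mathlib

/-- The pairs `(x, y)` with `1 ≤ x, y ≤ p ^ e * (p - 1)`, both prime to `p`, such that
`x ^ (x ^ n) ≡ y` and `y ^ (y ^ n) ≡ x` modulo `p ^ e`. -/
def twoCycles (p n e : ℕ) : Finset (ℕ × ℕ) :=
  (Finset.Icc 1 (p ^ e * (p - 1)) ×ˢ Finset.Icc 1 (p ^ e * (p - 1))).filter
    (fun xy => ¬ p ∣ xy.1 ∧ ¬ p ∣ xy.2 ∧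
      xy.1 ^ (xy.1 ^ n) ≡ xy.2 [MOD p ^ e] ∧ xy.2 ^ (xy.2 ^ n) ≡ xy.1 [MOD p ^ e])

/-- The two-cycles of the self-power map itself: `x ^ x ≡ y` and `y ^ y ≡ x` modulo `p ^ e`,
with `1 ≤ x, y ≤ p ^ e * (p - 1)`, both prime to `p`. -/
def selfPowerTwoCycles (p e : ℕ) : Finset (ℕ × ℕ) :=
  (Finset.Icc 1 (p ^ e * (p - 1)) ×ˢ Finset.Icc 1 (p ^ e * (p - 1))).filter
    (fun xy => ¬ p ∣ xy.1 ∧ ¬ p ∣ xy.2 ∧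
      xy.1 ^ xy.1 ≡ xy.2 [MOD p ^ e] ∧ xy.2 ^ xy.2 ≡ xy.1 [MOD p ^ e])

/-- `N_{z^n-1}(d)`: the number of residues `z` modulo `d` with `z ^ n - 1 ≡ 0` modulo `d`. -/
def numPowSubOne (n d : ℕ) : ℕ :=
  ((Finset.range d).filter (fun z : ℕ => (z : ℤ) ^ n - 1 ≡ 0 [ZMOD (d : ℤ)])).card

/-- `𝒩_{n(z^n+1)}(d)`: the number of residues `z` modulo `d`, relatively prime to `d`, with
`n * (z ^ n + 1) ≡ 0` modulo `d`. -/
def numCoprimeMulPowAddOne (n d : ℕ) : ℕ :=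
  ((Finset.range d).filter (fun z : ℕ => z.Coprime d ∧ n * (z ^ n + 1) ≡ 0 [MOD d])).card

/-! The first congruence determines y modulo p^e, and substituting it turns the second into x^m ≡ 1
modulo p^e with m = x^n y^n - 1. Put k = v_p(x^(p-1) - 1). Lifting the exponent gives v(x^m - 1) = k
+ v(m) once p divides x^m - 1. Moreover m ≡ x^(n(x^n+1)) - 1 modulo p^e, so the same rule applies to
m: v(m) may be replaced by 0, by k, or by 2k when p also divides x^n + 1. The condition is therefore
e ≤ k, e ≤ 2k or e ≤ 3k, according to the residues of x modulo p and of x, y modulo p - 1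
(`pow_mul_pow_modEq_iff`).

By the Chinese remainder theorem, a two-cycle amounts to x modulo p^e together with x and y modulo p
- 1 (`card_twoCycles_eq_sum`). Each unit ξ modulo p has p^(e-j) lifts with k ≥ j; taking j = e,
⌈e/2⌉, ⌈e/3⌉ gives 1, 1 + A, 1 + A + B lifts. Counting the ξ in the cyclic group of units yields the
gcds.

The divisor formula follows from gcd(m, k) = ∑ φ(d) over common divisors d, by exchanging sums and
using periodicity modulo d (`sum_sum_sum_divisors`). -/

/-! ### Lifting the exponent and the second congruence -/

theorem Nat.Prime.not_dvd_sub_one {p : ℕ} (hp : p.Prime) : ¬ p ∣ p - 1 := fun h => by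
  have := Nat.le_of_dvd (Nat.sub_pos_of_lt hp.one_lt) h
  have := hp.pos
  omega

/-- Lifting the exponent for `a ^ m - 1`. -/
theorem emultiplicity_pow_sub_one {p : ℕ} (hp : p.Prime) (hp2 : p ≠ 2) {a : ℤ}
    (h : (p : ℤ) ∣ a - 1) (m : ℕ) :
    emultiplicity (p : ℤ) (a ^ m - 1) = emultiplicity (p : ℤ) (a - 1) + emultiplicity p m := by
  have ha : ¬ (p : ℤ) ∣ a := fun h' => by
    have h1 : (p : ℤ) ∣ 1 := by simpa using dvd_sub h' h
    exact hp.one_lt.ne' (by exact_mod_cast Int.eq_one_of_dvd_one (by positivity) h1)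
  simpa using Int.emultiplicity_pow_sub_pow hp (hp.odd_of_ne_two hp2) h ha m

/-- The `p`-adic valuation of `x ^ m - 1`, when positive, is determined by those of
`x ^ (p - 1) - 1` and `m`. -/
theorem emultiplicity_pow_sub_one_of_dvd {p : ℕ} (hp : p.Prime) (hp2 : p ≠ 2) {x : ℤ}
    (hx : ¬ (p : ℤ) ∣ x) {m : ℕ} (h : (p : ℤ) ∣ x ^ m - 1) :
    emultiplicity (p : ℤ) (x ^ m - 1) =
      emultiplicity (p : ℤ) (x ^ (p - 1) - 1) + emultiplicity p m := by
  have hF : (p : ℤ) ∣ x ^ (p - 1) - 1 :=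
    (Int.ModEq.pow_card_sub_one_eq_one hp
      ((Nat.prime_iff_prime_int.1 hp).coprime_iff_not_dvd.2 hx).symm).symm.dvd
  -- The valuation of x^(m(p-1)) - 1 is computed twice, from (x^m)^(p-1) and from (x^(p-1))^m; the
  -- exponent p - 1 adds nothing.
  have h1 := emultiplicity_pow_sub_one hp hp2 h (p - 1)
  rw [emultiplicity_eq_zero.2 hp.not_dvd_sub_one, add_zero] at h1
  rw [← h1, ← emultiplicity_pow_sub_one hp hp2 hF, ← pow_mul, ← pow_mul, mul_comm]

/-- In x^(2n) - 1 = (x^n + 1)(x^n - 1) the second factor is prime to p, since p is odd, and 2n adds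
no valuation. -/
theorem emultiplicity_pow_add_one {p : ℕ} (hp : p.Prime) (hp2 : p ≠ 2) {x : ℤ}
    (hx : ¬ (p : ℤ) ∣ x) {n : ℕ} (hn : ¬ p ∣ n) (h : (p : ℤ) ∣ x ^ n + 1) :
    emultiplicity (p : ℤ) (x ^ n + 1) = emultiplicity (p : ℤ) (x ^ (p - 1) - 1) := by
  have hpZ := Nat.prime_iff_prime_int.1 hp
  have h2 : ¬ p ∣ 2 := fun h' => hp2 ((Nat.prime_dvd_prime_iff_eq hp Nat.prime_two).1 h')
  have hfac : x ^ (n * 2) - 1 = (x ^ n + 1) * (x ^ n - 1) := by ring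
  have h1 : ¬ (p : ℤ) ∣ x ^ n - 1 := fun h' => by
    have h3 : (p : ℤ) ∣ (2 : ℕ) := by
      have h4 := dvd_sub h h'
      rw [show (x ^ n + 1) - (x ^ n - 1) = ((2 : ℕ) : ℤ) by push_cast; ring] at h4
      exact h4
    exact h2 (by exact_mod_cast h3)
  have h3 := emultiplicity_pow_sub_one_of_dvd hp hp2 hx (m := n * 2)
    (hfac ▸ h.mul_right _)
  rwa [hfac, emultiplicity_mul hpZ, emultiplicity_eq_zero.2 h1, add_zero,
    emultiplicity_eq_zero.2 (fun h' => (hp.dvd_mul.1 h').elim hn h2), add_zero] at h3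

theorem le_emultiplicity_of_modEq {p a b : ℤ} {k : ℕ} (h : a ≡ b [ZMOD p ^ k]) :
    (k : ℕ∞) ≤ emultiplicity p a ↔ (k : ℕ∞) ≤ emultiplicity p b := by
  rw [← pow_dvd_iff_le_emultiplicity, ← pow_dvd_iff_le_emultiplicity]
  exact h.dvd_iff

/-- Valuations of numbers congruent modulo p^e agree up to the cutoff e. The summand k may be
infinite, as it is for x = 1. -/
theorem le_add_emultiplicity_of_modEq {p a b : ℤ} {e : ℕ} (h : a ≡ b [ZMOD p ^ e]) (k : ℕ∞) :
    (e : ℕ∞) ≤ k + emultiplicity p a ↔ (e : ℕ∞) ≤ k + emultiplicity p b := by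
  induction k using ENat.recTopCoe with
  | top => simp
  | coe k =>
    have hc : ∀ t : ℕ∞, (e : ℕ∞) ≤ k + t ↔ ((e - k : ℕ) : ℕ∞) ≤ t := fun t => by
      rw [ENat.natCast_sub, tsub_le_iff_left]
    rw [hc, hc]
    exact le_emultiplicity_of_modEq (h.of_dvd (pow_dvd_pow _ (Nat.sub_le _ _)))

/-- If `y ≡ x ^ (x ^ n)`, then `y ^ (y ^ n) ≡ x` can be read off from the residue of `x` modulo `p`
and the valuation of `x ^ (p - 1) - 1`. -/
theorem pow_mul_pow_modEq_iff {p : ℕ} (hp : p.Prime) (hp2 : p ≠ 2) {e n x y : ℕ} (he : 1 ≤ e)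
    (hn : ¬ p ∣ n) (hx : ¬ p ∣ x) (hxy : x ^ x ^ n ≡ y [MOD p ^ e]) :
    y ^ y ^ n ≡ x [MOD p ^ e] ↔
      (p : ℤ) ∣ (x : ℤ) ^ (x ^ n * y ^ n - 1) - 1 ∧
      ((e : ℕ∞) ≤ emultiplicity (p : ℤ) ((x : ℤ) ^ (p - 1) - 1) ∨
        ((p : ℤ) ∣ (x : ℤ) ^ (n * (x ^ n + 1)) - 1 ∧
          ((e : ℕ∞) ≤ 2 * emultiplicity (p : ℤ) ((x : ℤ) ^ (p - 1) - 1) ∨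
            ((p : ℤ) ∣ (x : ℤ) ^ n + 1 ∧
              (e : ℕ∞) ≤ 3 * emultiplicity (p : ℤ) ((x : ℤ) ^ (p - 1) - 1))))) := by
  have hxZ : ¬ (p : ℤ) ∣ x := fun h => hx (by exact_mod_cast h)
  have hy : ¬ p ∣ y := fun h => hx (hp.dvd_of_dvd_pow
    ((hxy.dvd_iff (dvd_pow_self p (by omega))).2 h))
  have hpos : 0 < x ^ n * y ^ n := by
    have : 0 < x := Nat.pos_of_ne_zero fun h => hx (h ▸ dvd_zero _)
    have : 0 < y := Nat.pos_of_ne_zero fun h => hy (h ▸ dvd_zero _)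
    positivity
  set k := emultiplicity (p : ℤ) ((x : ℤ) ^ (p - 1) - 1) with hk
  obtain ⟨m, hm⟩ : ∃ m, x ^ n * y ^ n = m + 1 := ⟨x ^ n * y ^ n - 1, by omega⟩
  have hcop : Nat.gcd (p ^ e) x = 1 := ((Nat.Prime.coprime_iff_not_dvd hp).2 hx).pow_left e
  have hyx : y ^ y ^ n ≡ x ^ (m + 1) [MOD p ^ e] := by
    rw [← hm, pow_mul]; exact (hxy.pow _).symm
  have step1 : y ^ y ^ n ≡ x [MOD p ^ e] ↔ (p : ℤ) ^ e ∣ (x : ℤ) ^ m - 1 := by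
    have h1 : y ^ y ^ n ≡ x [MOD p ^ e] ↔ x * x ^ m ≡ x * 1 [MOD p ^ e] := by
      rw [← pow_succ', mul_one]
      exact ⟨fun h => hyx.symm.trans h, fun h => hyx.trans h⟩
    rw [h1, Nat.ModEq.comm]
    have h2 : x * 1 ≡ x * x ^ m [MOD p ^ e] ↔ 1 ≡ x ^ m [MOD p ^ e] :=
      ⟨fun h => Nat.ModEq.cancel_left_of_coprime hcop h, fun h => h.mul_left x⟩
    rw [h2, Nat.modEq_iff_dvd]
    push_cast
    rfl
  rw [step1, hm, Nat.add_sub_cancel]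
  have step2 : (p : ℤ) ^ e ∣ (x : ℤ) ^ m - 1 ↔
      (p : ℤ) ∣ (x : ℤ) ^ m - 1 ∧ (e : ℕ∞) ≤ k + emultiplicity p m := by
    rw [pow_dvd_iff_le_emultiplicity]
    constructor
    · intro h
      have h1 : (p : ℤ) ∣ (x : ℤ) ^ m - 1 :=
        (dvd_pow_self _ (by omega)).trans (pow_dvd_iff_le_emultiplicity.2 h)
      exact ⟨h1, emultiplicity_pow_sub_one_of_dvd hp hp2 hxZ h1 ▸ h⟩
    · rintro ⟨h1, h2⟩
      rwa [emultiplicity_pow_sub_one_of_dvd hp hp2 hxZ h1]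
  rw [step2]
  refine and_congr_right fun _ => ?_
  -- Here y^n ≡ x^(n x^n), hence x^n y^n ≡ x^(n(x^n+1)).
  have hmod : (m : ℤ) ≡ (x : ℤ) ^ (n * (x ^ n + 1)) - 1 [ZMOD (p : ℤ) ^ e] := by
    have h1 : (m : ℤ) = ((x ^ n * y ^ n : ℕ) : ℤ) - 1 := by rw [hm]; push_cast; ring
    have h2 : x ^ n * y ^ n ≡ x ^ (n * (x ^ n + 1)) [MOD p ^ e] := by
      have : x ^ (n * (x ^ n + 1)) = x ^ n * (x ^ x ^ n) ^ n := by
        rw [← pow_mul, ← pow_add]; ring_nf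
      rw [this]
      exact (hxy.symm.pow n).mul_left _
    rw [h1]
    have h3 := (Int.natCast_modEq_iff.2 h2).sub_right 1
    push_cast at h3 ⊢
    exact h3
  rw [← Int.natCast_emultiplicity, le_add_emultiplicity_of_modEq hmod]
  by_cases h1 : (p : ℤ) ∣ (x : ℤ) ^ (n * (x ^ n + 1)) - 1
  · rw [emultiplicity_pow_sub_one_of_dvd hp hp2 hxZ h1, ← hk, Nat.Prime.emultiplicity_mul hp,
      emultiplicity_eq_zero.2 hn, zero_add, ← Int.natCast_emultiplicity]
    push_cast
    by_cases h2 : (p : ℤ) ∣ (x : ℤ) ^ n + 1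
    · rw [emultiplicity_pow_add_one hp hp2 hxZ hn h2, ← hk]
      have h3 : k + (k + k) = 3 * k := by ring
      have h4 : k ≤ 3 * k := h3 ▸ le_self_add
      have h5 : 2 * k ≤ 3 * k := by rw [← h3, two_mul]; exact le_add_self
      rw [h3]
      simp only [h1, h2, true_and]
      exact ⟨fun h => .inr (.inr h), fun h => h.elim (·.trans h4) (·.elim (·.trans h5) id)⟩
    · rw [emultiplicity_eq_zero.2 h2, add_zero, ← two_mul]
      have h4 : k ≤ 2 * k := by rw [two_mul]; exact le_self_add
      simp only [h1, h2, true_and, false_and, or_false]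
      exact ⟨fun h => .inr h, fun h => h.elim (·.trans h4) id⟩
  · rw [emultiplicity_eq_zero.2 h1]
    simp [h1]

/-- The hypothesis says that j = ⌈e/c⌉. -/
theorem pow_dvd_iff_le_mul_emultiplicity {p a : ℤ} {c j e : ℕ} (h : ∀ k, e ≤ c * k ↔ j ≤ k)
    (hc : c ≠ 0) : (e : ℕ∞) ≤ c * emultiplicity p a ↔ p ^ j ∣ a := by
  rw [pow_dvd_iff_le_emultiplicity]
  generalize emultiplicity p a = k
  induction k using ENat.recTopCoe with
  | top => simp [ENat.mul_top, hc]
  | coe k => exact_mod_cast h k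

/-! ### Representatives and the Chinese remainder theorem -/

theorem Nat.exists_mem_Icc_modEq_and_modEq {P q : ℕ} (hP : 0 < P) (hq : 0 < q)
    (h : P.Coprime q) (u v : ℕ) :
    ∃ x ∈ Finset.Icc 1 (P * q), x ≡ u [MOD P] ∧ x ≡ v [MOD q] := by
  obtain ⟨z, hz⟩ := Nat.chineseRemainder h u v
  have hN : 0 < P * q := Nat.mul_pos hP hq
  -- Shifting by -1 before reduction and by +1 after it lands in 1, …, Pq instead of 0, …, Pq - 1.
  refine ⟨(z + (P * q - 1)) % (P * q) + 1,
    Finset.mem_Icc.2 ⟨by omega, Nat.mod_lt _ hN⟩, ?_⟩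
  have h1 : (z + (P * q - 1)) % (P * q) + 1 ≡ z [MOD P * q] := by
    refine ((Nat.mod_modEq _ _).add_right 1).trans ?_
    rw [show z + (P * q - 1) + 1 = z + P * q by omega]
    simp [Nat.ModEq]
  exact ⟨(h1.of_mul_right q).trans hz.1, (h1.of_mul_left P).trans hz.2⟩

theorem Nat.ModEq.eq_of_mem_Icc {N x y : ℕ} (h : x ≡ y [MOD N]) (hx : x ∈ Finset.Icc 1 N)
    (hy : y ∈ Finset.Icc 1 N) : x = y := by
  rw [Finset.mem_Icc] at hx hy
  have h1 : x - 1 ≡ y - 1 [MOD N] := by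
    refine Nat.ModEq.add_right_cancel' 1 ?_
    rwa [Nat.sub_add_cancel hx.1, Nat.sub_add_cancel hy.1]
  have := h1.eq_of_lt_of_lt (by omega) (by omega)
  omega

theorem Nat.exists_mem_Icc_modEq {q : ℕ} (hq : 0 < q) (v : ℕ) :
    ∃ x ∈ Finset.Icc 1 q, x ≡ v [MOD q] := by
  obtain ⟨x, hx, -, h⟩ := Nat.exists_mem_Icc_modEq_and_modEq one_pos hq (by simp) 0 v
  exact ⟨x, by simpa using hx, h⟩

theorem Nat.ModEq.sub_one {q x y : ℕ} (h : x ≡ y [MOD q]) (hx : 0 < x) (hy : 0 < y) :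
    x - 1 ≡ y - 1 [MOD q] := by
  refine Nat.ModEq.add_right_cancel' 1 ?_
  rwa [Nat.sub_add_cancel hx, Nat.sub_add_cancel hy]

theorem ZMod.pow_eq_pow_of_modEq {p : ℕ} (hp : p.Prime) {z : ZMod p} (hz : z ≠ 0) {m m' : ℕ}
    (h : m ≡ m' [MOD p - 1]) : z ^ m = z ^ m' := by
  have := Fact.mk hp
  exact _root_.pow_eq_pow_of_modEq h (ZMod.pow_card_sub_one_eq_one hz)

/-! ### Reduction to residues modulo p^e and p - 1 -/

/-- The condition on the residue `X` of `x` modulo `p ^ e` for `x` to belong to a two-cycle `(x, y)`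
with `x ≡ a` and `y ≡ b` modulo `p - 1`. -/
def IsCycleResidue (p e n a b X : ℕ) : Prop :=
  (X : ZMod p) ≠ 0 ∧ (X : ZMod p) ^ (a ^ n * b ^ n - 1) = 1 ∧
    (X ^ (p - 1) ≡ 1 [MOD p ^ e] ∨
      ((X : ZMod p) ^ (n * (a ^ n + 1)) = 1 ∧
        (X ^ (p - 1) ≡ 1 [MOD p ^ ((e + 1) / 2)] ∨
          ((X : ZMod p) ^ n = -1 ∧ X ^ (p - 1) ≡ 1 [MOD p ^ ((e + 2) / 3)]))))

theorem isCycleResidue_congr {p e n a b X X' : ℕ} (he : 1 ≤ e) (h : X ≡ X' [MOD p ^ e]) :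
    IsCycleResidue p e n a b X ↔ IsCycleResidue p e n a b X' := by
  have h1 : ∀ j ≤ e, (X ^ (p - 1) ≡ 1 [MOD p ^ j] ↔ X' ^ (p - 1) ≡ 1 [MOD p ^ j]) := by
    intro j hj
    have := (h.of_dvd (pow_dvd_pow p hj)).pow (p - 1)
    exact ⟨this.symm.trans, this.trans⟩
  have h2 : (X : ZMod p) = X' :=
    (ZMod.natCast_eq_natCast_iff _ _ _).2 (h.of_dvd (dvd_pow_self p (by omega)))
  unfold IsCycleResidue
  rw [h1 e le_rfl, h1 ((e + 1) / 2) (by omega), h1 ((e + 2) / 3) (by omega), h2]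

theorem pow_modEq_iff_isCycleResidue {p : ℕ} (hp : p.Prime) (hp2 : p ≠ 2) {e n x y a b : ℕ}
    (he : 1 ≤ e) (hn : ¬ p ∣ n) (hx : ¬ p ∣ x) (hxy : x ^ x ^ n ≡ y [MOD p ^ e])
    (hxa : x ≡ a [MOD p - 1]) (hyb : y ≡ b [MOD p - 1]) (ha : 1 ≤ a) (hb : 1 ≤ b) :
    y ^ y ^ n ≡ x [MOD p ^ e] ↔ IsCycleResidue p e n a b x := by
  have hx0 : (x : ZMod p) ≠ 0 := fun h => hx ((ZMod.natCast_eq_zero_iff _ _).1 h)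
  have hxpos : 0 < x := Nat.pos_of_ne_zero fun h => hx (h ▸ dvd_zero _)
  have hypos : 0 < y := Nat.pos_of_ne_zero fun h => hx <| by
    subst h
    exact hp.dvd_of_dvd_pow ((hxy.dvd_iff (dvd_pow_self p (by omega))).2 (dvd_zero _))
  have hsub : ∀ m, (p : ℤ) ∣ (x : ℤ) ^ m - 1 ↔ (x : ZMod p) ^ m = 1 := fun m => by
    rw [← ZMod.intCast_zmod_eq_zero_iff_dvd]; push_cast; rw [sub_eq_zero]
  have hadd : (p : ℤ) ∣ (x : ℤ) ^ n + 1 ↔ (x : ZMod p) ^ n = -1 := by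
    rw [← ZMod.intCast_zmod_eq_zero_iff_dvd]; push_cast; rw [eq_neg_iff_add_eq_zero]
  have hk : ∀ c j, c ≠ 0 → (∀ k, e ≤ c * k ↔ j ≤ k) →
      ((e : ℕ∞) ≤ c * emultiplicity (p : ℤ) ((x : ℤ) ^ (p - 1) - 1) ↔
        x ^ (p - 1) ≡ 1 [MOD p ^ j]) := fun c j hc h => by
    rw [pow_dvd_iff_le_mul_emultiplicity h hc, Nat.ModEq.comm, Nat.modEq_iff_dvd]
    push_cast; rfl
  have hk1 := hk 1 e one_ne_zero (by simp)
  -- (e + 1) / 2 and (e + 2) / 3 are ⌈e/2⌉ and ⌈e/3⌉.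
  have hk2 := hk 2 ((e + 1) / 2) two_ne_zero (by omega)
  have hk3 := hk 3 ((e + 2) / 3) three_ne_zero (by omega)
  rw [Nat.cast_one, one_mul] at hk1
  rw [pow_mul_pow_modEq_iff hp hp2 he hn hx hxy, hsub, hsub, hadd, hk1,
    show (2 : ℕ∞) = (2 : ℕ) from rfl, hk2, show (3 : ℕ∞) = (3 : ℕ) from rfl, hk3]
  -- By Fermat, exponents matter only modulo p - 1, so x and y in them become a and b; positivity
  -- guards the truncated subtraction.
  rw [ZMod.pow_eq_pow_of_modEq hp hx0 (((hxa.pow n).mul (hyb.pow n)).sub_one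
      (by positivity) (by positivity)),
    ZMod.pow_eq_pow_of_modEq hp hx0 (((hxa.pow n).add_right 1).mul_left n)]
  simp [IsCycleResidue, hx0]

open Classical in
-- Since p^e and p - 1 are coprime, x is free in both moduli, whereas y modulo p^e is forced and
-- only y modulo p - 1 is free.
theorem card_twoCycles_eq_sum {p : ℕ} (hp : p.Prime) (hp2 : p ≠ 2) {e n : ℕ}
    (he : 1 ≤ e) (hn : ¬ p ∣ n) :
    (twoCycles p n e).card = ∑ a ∈ Finset.Icc 1 (p - 1), ∑ b ∈ Finset.Icc 1 (p - 1),
      ((Finset.range (p ^ e)).filter (IsCycleResidue p e n a b)).card := by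
  have hq : 0 < p - 1 := Nat.sub_pos_of_lt hp.one_lt
  have hP : 0 < p ^ e := pow_pos hp.pos e
  have hcop : (p ^ e).Coprime (p - 1) :=
    ((Nat.Prime.coprime_iff_not_dvd hp).2 hp.not_dvd_sub_one).pow_left e
  choose r hr hr' using fun v : ℕ => Nat.exists_mem_Icc_modEq hq v
  have hT : ∑ a ∈ Finset.Icc 1 (p - 1), ∑ b ∈ Finset.Icc 1 (p - 1),
      ((Finset.range (p ^ e)).filter (IsCycleResidue p e n a b)).card =
      (((Finset.Icc 1 (p - 1) ×ˢ Finset.Icc 1 (p - 1)) ×ˢ Finset.range (p ^ e)).filter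
        fun t : (ℕ × ℕ) × ℕ => IsCycleResidue p e n t.1.1 t.1.2 t.2).card := by
    simp_rw [Finset.card_filter, Finset.sum_product]
  rw [hT]
  refine Finset.card_bij (fun xy _ => ((r xy.1, r xy.2), xy.1 % p ^ e)) ?_ ?_ ?_
  · rintro ⟨x, y⟩ h
    obtain ⟨-, hx, -, h1, h2⟩ := Finset.mem_filter.1 h
    simp only [Finset.mem_filter, Finset.mem_product, Finset.mem_range]
    refine ⟨⟨⟨hr x, hr y⟩, Nat.mod_lt _ hP⟩, ?_⟩
    rw [isCycleResidue_congr he (Nat.mod_modEq x _)]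
    exact (pow_modEq_iff_isCycleResidue hp hp2 he hn hx h1 (hr' x).symm (hr' y).symm
      (Finset.mem_Icc.1 (hr x)).1 (Finset.mem_Icc.1 (hr y)).1).1 h2
  · rintro ⟨x, y⟩ h ⟨x', y'⟩ h' heq
    obtain ⟨hm, -, -, h1, -⟩ := Finset.mem_filter.1 h
    obtain ⟨hm', -, -, h1', -⟩ := Finset.mem_filter.1 h'
    rw [Finset.mem_product] at hm hm'
    simp only [Prod.mk.injEq] at heq h1 h1'
    obtain ⟨⟨hx, hy⟩, hX⟩ := heq
    have hxx : x = x' := Nat.ModEq.eq_of_mem_Icc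
      ((Nat.modEq_and_modEq_iff_modEq_mul hcop).1
        ⟨hX, (hr' x).symm.trans (hx ▸ hr' x')⟩) hm.1 hm'.1
    subst hxx
    have hyy : y = y' := Nat.ModEq.eq_of_mem_Icc
      ((Nat.modEq_and_modEq_iff_modEq_mul hcop).1
        ⟨h1.symm.trans h1', (hr' y).symm.trans (hy ▸ hr' y')⟩) hm.2 hm'.2
    rw [hyy]
  · rintro ⟨⟨a, b⟩, X⟩ h
    simp only [Finset.mem_filter, Finset.mem_product, Finset.mem_range] at h
    obtain ⟨⟨⟨ha, hb⟩, hX⟩, hC⟩ := h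
    obtain ⟨x, hxm, hxX, hxa⟩ := Nat.exists_mem_Icc_modEq_and_modEq hP hq hcop X a
    -- The residue of y modulo p^e uses x itself, because x^(x^n) depends on more than X.
    obtain ⟨y, hym, hyx, hyb⟩ := Nat.exists_mem_Icc_modEq_and_modEq hP hq hcop (x ^ x ^ n) b
    rw [← isCycleResidue_congr he hxX] at hC
    have hx : ¬ p ∣ x := fun h => hC.1 ((ZMod.natCast_eq_zero_iff _ _).2 h)
    have hy : ¬ p ∣ y := fun h => hx (hp.dvd_of_dvd_pow
      ((hyx.dvd_iff (dvd_pow_self p (by omega))).1 h))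
    refine ⟨(x, y), Finset.mem_filter.2 ⟨Finset.mem_product.2 ⟨hxm, hym⟩, hx, hy, hyx.symm, ?_⟩, ?_⟩
    · exact (pow_modEq_iff_isCycleResidue hp hp2 he hn hx hyx.symm hxa hyb
        (Finset.mem_Icc.1 ha).1 (Finset.mem_Icc.1 hb).1).2 hC
    · have h1 : r x = a := ((hr' x).trans hxa).eq_of_mem_Icc (hr x) ha
      have h2 : r y = b := ((hr' y).trans hyb).eq_of_mem_Icc (hr y) hb
      have h3 : x % p ^ e = X := Nat.mod_eq_of_modEq hxX hX
      simp only [h1, h2, h3]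

/-! ### Lifts of a unit modulo p -/

/-- Each nonzero residue class modulo `p` contains a unique `(p - 1)`-st root of unity modulo
`p ^ j`. -/
theorem modEq_and_pow_sub_one_modEq_one_iff {p : ℕ} (hp : p.Prime) {t X j : ℕ} (ht : ¬ p ∣ t)
    (hj : 1 ≤ j) :
    X ≡ t [MOD p] ∧ X ^ (p - 1) ≡ 1 [MOD p ^ j] ↔ X ≡ t ^ p ^ (j - 1) [MOD p ^ j] := by
  have := Fact.mk hp
  constructor
  · rintro ⟨h1, h2⟩
    -- Each p-th power raises a congruence by one power of p. As p - 1 divides p^(j-1) - 1, the left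
    -- side is X again.
    have h3 : X ^ p ^ (j - 1) ≡ t ^ p ^ (j - 1) [MOD p ^ j] := by
      rw [Nat.ModEq.comm, Nat.modEq_iff_dvd]
      have := dvd_sub_pow_of_dvd_sub (R := ℤ) (Nat.modEq_iff_dvd.1 h1.symm) (j - 1)
      rw [Nat.sub_add_cancel hj] at this
      push_cast
      exact this
    obtain ⟨c, hc⟩ : p - 1 ∣ p ^ (j - 1) - 1 := by
      simpa using Nat.sub_dvd_pow_sub_pow p 1 (j - 1)
    have h4 : p ^ (j - 1) = (p - 1) * c + 1 := by
      have : 0 < p ^ (j - 1) := pow_pos hp.pos _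
      omega
    refine Nat.ModEq.trans ?_ h3
    rw [h4, pow_succ, pow_mul]
    have := ((h2.pow c).mul_right X).symm
    rwa [one_pow, one_mul] at this
  · intro h
    constructor
    · refine (h.of_dvd (dvd_pow_self p (by omega))).trans ?_
      rw [← ZMod.natCast_eq_natCast_iff]
      push_cast
      exact ZMod.pow_card_pow _
    · refine (h.pow (p - 1)).trans ?_
      rw [← pow_mul, ← Nat.totient_prime_pow hp hj]
      exact Nat.ModEq.pow_totient ((((Nat.Prime.coprime_iff_not_dvd hp).2 ht).symm).pow_right j)

theorem card_range_pow_filter_modEq {p e j : ℕ} (hp : p.Prime) (hj : j ≤ e) (v : ℕ) :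
    ((Finset.range (p ^ e)).filter (· ≡ v [MOD p ^ j])).card = p ^ (e - j) := by
  rw [← Nat.count_eq_card_filter_range, Nat.count_modEq_card _ (pow_pos hp.pos j),
    Nat.mod_eq_zero_of_dvd (pow_dvd_pow p hj), Nat.pow_div hj hp.pos]
  simp

theorem card_range_pow_filter_pow_sub_one {p e j : ℕ} (hp : p.Prime) (hj : 1 ≤ j) (hje : j ≤ e)
    (ξ : (ZMod p)ˣ) :
    ((Finset.range (p ^ e)).filter
      fun X : ℕ => (X : ZMod p) = ξ ∧ X ^ (p - 1) ≡ 1 [MOD p ^ j]).card = p ^ (e - j) := by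
  have := Fact.mk hp
  have hξ : ((ξ : ZMod p).val : ZMod p) = ξ := ZMod.natCast_zmod_val _
  have ht : ¬ p ∣ (ξ : ZMod p).val := fun h =>
    ξ.ne_zero (hξ ▸ (ZMod.natCast_eq_zero_iff _ _).2 h)
  rw [← card_range_pow_filter_modEq hp hje ((ξ : ZMod p).val ^ p ^ (j - 1))]
  congr 1
  refine Finset.filter_congr fun X _ => ?_
  rw [← modEq_and_pow_sub_one_modEq_one_iff hp ht hj, ← ZMod.natCast_eq_natCast_iff X _ p, hξ]

/-! ### Counting units modulo p -/

theorem card_units_pow_eq_one {p : ℕ} [Fact p.Prime] (m : ℕ) :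
    (Finset.univ.filter fun ξ : (ZMod p)ˣ => ξ ^ m = 1).card = (p - 1).gcd m := by
  rw [← ZMod.card_units p, ← Nat.card_eq_fintype_card,
    ← IsCyclic.card_powMonoidHom_ker (ZMod p)ˣ m, ← Fintype.card_subtype,
    ← Nat.card_eq_fintype_card]
  rfl

theorem pow_eq_one_and_pow_eq_one_iff {G : Type*} [Group G] (g : G) (i j : ℕ) :
    g ^ i = 1 ∧ g ^ j = 1 ↔ g ^ i.gcd j = 1 := by
  simp only [← orderOf_dvd_iff_pow_eq_one, Nat.dvd_gcd_iff]

theorem units_pow_two_mul_eq_one_iff {p : ℕ} [Fact p.Prime] (ξ : (ZMod p)ˣ) (n : ℕ) :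
    ξ ^ (2 * n) = 1 ↔ ξ ^ n = 1 ∨ ξ ^ n = -1 := by
  rw [mul_comm, pow_mul, ← Units.val_inj, ← Units.val_inj (b := 1), ← Units.val_inj (b := -1)]
  simp

theorem ZMod.units_one_ne_neg_one {p : ℕ} [Fact p.Prime] (hp2 : p ≠ 2) : (1 : (ZMod p)ˣ) ≠ -1 := by
  have : Fact (2 < p) := ⟨lt_of_le_of_ne (Fact.out : p.Prime).two_le hp2.symm⟩
  intro h
  exact ZMod.neg_one_ne_one (n := p) (by simpa using (congrArg Units.val h).symm)

/-- The solutions of ξ^(2n) = 1 split disjointly into those of ξ^n = 1 and ξ^n = -1. -/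
theorem card_units_pow_eq_neg_one {p : ℕ} [Fact p.Prime] (hp2 : p ≠ 2) (m n : ℕ) :
    ((Finset.univ.filter fun ξ : (ZMod p)ˣ => ξ ^ m = 1 ∧ ξ ^ n = -1).card : ℤ) =
      ((p - 1).gcd ((2 * n).gcd m) : ℤ) - ((p - 1).gcd (n.gcd m) : ℤ) := by
  rw [eq_sub_iff_add_eq, ← card_units_pow_eq_one, ← card_units_pow_eq_one, ← Nat.cast_add,
    ← Finset.card_union_of_disjoint, ← Finset.filter_or]
  · congr 2
    refine Finset.filter_congr fun ξ _ => ?_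
    rw [← pow_eq_one_and_pow_eq_one_iff, ← pow_eq_one_and_pow_eq_one_iff,
      units_pow_two_mul_eq_one_iff]
    tauto
  · refine Finset.disjoint_filter.2 fun ξ _ h h' => ?_
    exact ZMod.units_one_ne_neg_one hp2
      (((pow_eq_one_and_pow_eq_one_iff _ _ _).2 h').1.symm.trans h.2)

open Classical in
-- The three conditions on ξ are nested, so the lift counts telescope: each stronger condition adds
-- the difference of two powers of p.
theorem card_isCycleResidue_of_unit {p : ℕ} [Fact p.Prime] (hp2 : p ≠ 2) {e n a b : ℕ} (he : 1 ≤ e)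
    (ha : 1 ≤ a) (hb : 1 ≤ b) (ξ : (ZMod p)ˣ) :
    (((Finset.range (p ^ e)).filter
        fun X : ℕ => (X : ZMod p) = ξ ∧ IsCycleResidue p e n a b X).card : ℤ) =
      (if ξ ^ (a ^ n * b ^ n - 1) = 1 then 1 else 0)
      + (if ξ ^ (a ^ n * b ^ n - 1) = 1 ∧ ξ ^ (n * (a ^ n + 1)) = 1 then 1 else 0)
        * ((p : ℤ) ^ (e / 2) - 1)
      + (if ξ ^ (a ^ n * b ^ n - 1) = 1 ∧ ξ ^ n = -1 then 1 else 0)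
        * ((p : ℤ) ^ (e / 3 + (e + 1) / 3) - (p : ℤ) ^ (e / 2)) := by
  have hp : p.Prime := Fact.out
  have hval : ∀ m (η : (ZMod p)ˣ), (ξ : ZMod p) ^ m = η ↔ ξ ^ m = η := fun m η => by
    rw [← Units.val_inj, Units.val_pow_eq_pow_val]
  have hval1 : ∀ m, (ξ : ZMod p) ^ m = 1 ↔ ξ ^ m = 1 := fun m => by
    rw [← hval, Units.val_one]
  have hvaln : ∀ m, (ξ : ZMod p) ^ m = -1 ↔ ξ ^ m = -1 := fun m => by
    rw [← hval, Units.val_neg, Units.val_one]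
  have hcard : ∀ j, 1 ≤ j → j ≤ e →
      (∀ X : ℕ, (X : ZMod p) = ξ →
        (IsCycleResidue p e n a b X ↔ X ^ (p - 1) ≡ 1 [MOD p ^ j])) →
      (((Finset.range (p ^ e)).filter
        fun X : ℕ => (X : ZMod p) = ξ ∧ IsCycleResidue p e n a b X).card : ℤ) =
      (p : ℤ) ^ (e - j) := fun j hj hje h => by
    rw [← Nat.cast_pow, ← card_range_pow_filter_pow_sub_one hp hj hje ξ]
    congr 2
    exact Finset.filter_congr fun X _ => and_congr_right (h X)
  have hmono : ∀ {X i j : ℕ}, i ≤ j → X ^ (p - 1) ≡ 1 [MOD p ^ j] →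
    X ^ (p - 1) ≡ 1 [MOD p ^ i] := fun hij h => h.of_dvd (pow_dvd_pow p hij)
  by_cases h1 : ξ ^ (a ^ n * b ^ n - 1) = 1
  -- Raising the first condition to the n-th power gives (-1)^(a^n b^n - 1) = 1, so a^n is odd and
  -- a^n + 1 is even.
  · have h32 : ξ ^ n = -1 → ξ ^ (n * (a ^ n + 1)) = 1 := fun h => by
      have hE : Even (a ^ n * b ^ n - 1) := by
        by_contra hE
        have h4 : ξ ^ (n * (a ^ n * b ^ n - 1)) = 1 := by rw [mul_comm, pow_mul, h1, one_pow]
        rw [pow_mul, h, (Nat.not_even_iff_odd.1 hE).neg_one_pow] at h4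
        exact ZMod.units_one_ne_neg_one hp2 h4.symm
      have hpos : 1 ≤ a ^ n * b ^ n := Nat.mul_pos (pow_pos ha n) (pow_pos hb n)
      have hodd : Odd (a ^ n * b ^ n) := by
        rw [← Nat.sub_add_cancel hpos]; exact hE.add_one
      rw [pow_mul, h, (Nat.odd_mul.1 hodd).1.add_one.neg_one_pow]
    by_cases h2 : ξ ^ (n * (a ^ n + 1)) = 1
    · by_cases h3 : ξ ^ n = -1
      · rw [hcard ((e + 2) / 3) (by omega) (by omega)]
        · rw [show e - (e + 2) / 3 = e / 3 + (e + 1) / 3 by omega]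
          simp [h1, h2, h3]
        · intro X hX
          simp only [IsCycleResidue, hX, hval1, hvaln, h1, h2, h3, ξ.ne_zero, ne_eq,
            not_false_eq_true, true_and]
          exact ⟨fun h => h.elim (hmono (by omega)) (·.elim (hmono (by omega)) id),
            fun h => .inr (.inr h)⟩
      · rw [hcard ((e + 1) / 2) (by omega) (by omega)]
        · rw [show e - (e + 1) / 2 = e / 2 by omega]
          simp [h1, h2, h3]
        · intro X hX
          simp only [IsCycleResidue, hX, hval1, hvaln, h1, h2, h3, ξ.ne_zero, ne_eq,
            not_false_eq_true, true_and, false_and, or_false]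
          exact ⟨fun h => h.elim (hmono (by omega)) id, .inr⟩
    · have h3 : ξ ^ n ≠ -1 := fun h => h2 (h32 h)
      rw [hcard e he le_rfl]
      · simp [h1, h2, h3]
      · intro X hX
        simp [IsCycleResidue, hX, hval1, hvaln, h1, h2]
  · rw [Finset.filter_false_of_mem]
    · simp [h1]
    · rintro X - ⟨hX, -, h, -⟩
      rw [hX, hval1] at h
      exact h1 h

open Classical in
theorem card_isCycleResidue {p : ℕ} [Fact p.Prime] (hp2 : p ≠ 2) {e n a b : ℕ} (he : 1 ≤ e)
    (ha : 1 ≤ a) (hb : 1 ≤ b) :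
    (((Finset.range (p ^ e)).filter (IsCycleResidue p e n a b)).card : ℤ) =
      ((p - 1).gcd (a ^ n * b ^ n - 1) : ℤ)
      + ((p - 1).gcd ((n * (a ^ n + 1)).gcd (a ^ n * b ^ n - 1)) : ℤ) * ((p : ℤ) ^ (e / 2) - 1)
      + (((p - 1).gcd ((2 * n).gcd (a ^ n * b ^ n - 1)) : ℤ)
          - ((p - 1).gcd (n.gcd (a ^ n * b ^ n - 1)) : ℤ))
        * ((p : ℤ) ^ (e / 3 + (e + 1) / 3) - (p : ℤ) ^ (e / 2)) := by
  have h1 : ((Finset.range (p ^ e)).filter (IsCycleResidue p e n a b)).card =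
      ∑ ξ : (ZMod p)ˣ, ((Finset.range (p ^ e)).filter
        fun X : ℕ => (X : ZMod p) = ξ ∧ IsCycleResidue p e n a b X).card := by
    rw [Finset.card_eq_sum_card_fiberwise (t := Finset.univ)
      -- The default value 1 is harmless: a cycle residue is nonzero modulo p.
      (f := fun X : ℕ => if h : (X : ZMod p) = 0 then 1 else Units.mk0 (X : ZMod p) h)
      (fun _ _ => Finset.mem_coe.2 (Finset.mem_univ _))]
    refine Finset.sum_congr rfl fun ξ _ => ?_
    rw [Finset.filter_filter]
    congr 1
    refine Finset.filter_congr fun X _ => ?_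
    rw [and_comm]
    refine and_congr_left fun h => ?_
    rw [dif_neg h.1, ← Units.val_inj, Units.val_mk0]
  rw [h1, Nat.cast_sum, Finset.sum_congr rfl fun ξ _ =>
    card_isCycleResidue_of_unit hp2 he ha hb ξ, Finset.sum_add_distrib, Finset.sum_add_distrib,
    ← Finset.sum_mul, ← Finset.sum_mul, Finset.sum_boole, Finset.sum_boole, Finset.sum_boole]
  rw [card_units_pow_eq_one, card_units_pow_eq_neg_one hp2]
  simp_rw [pow_eq_one_and_pow_eq_one_iff]
  rw [card_units_pow_eq_one, Nat.gcd_comm (a ^ n * b ^ n - 1)]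

theorem card_twoCycles_eq_sum_gcd {p : ℕ} (hp : p.Prime) (hp2 : p ≠ 2) {e n : ℕ} (he : 1 ≤ e)
    (hn : ¬ p ∣ n) :
    ((twoCycles p n e).card : ℤ) =
      (∑ x₀ ∈ Finset.Icc 1 (p - 1), ∑ y₀ ∈ Finset.Icc 1 (p - 1),
        (Nat.gcd (p - 1) (x₀ ^ n * y₀ ^ n - 1) : ℤ))
      + (∑ x₀ ∈ Finset.Icc 1 (p - 1), ∑ y₀ ∈ Finset.Icc 1 (p - 1),
        (Nat.gcd (p - 1) (Nat.gcd (n * (y₀ ^ n + 1)) (x₀ ^ n * y₀ ^ n - 1)) : ℤ)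
          * ((p : ℤ) ^ (e / 2) - 1))
      + (∑ x₀ ∈ Finset.Icc 1 (p - 1), ∑ y₀ ∈ Finset.Icc 1 (p - 1),
        ((Nat.gcd (p - 1) (Nat.gcd (2 * n) (x₀ ^ n * y₀ ^ n - 1)) : ℤ)
          - (Nat.gcd (p - 1) (Nat.gcd n (x₀ ^ n * y₀ ^ n - 1)) : ℤ))
          * ((p : ℤ) ^ (e / 3 + (e + 1) / 3) - (p : ℤ) ^ (e / 2))) := by
  have := Fact.mk hp
  -- The local count involves a^n + 1 with a attached to x, the target y₀^n + 1; the roles are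
  -- exchanged.
  rw [card_twoCycles_eq_sum hp hp2 he hn, Finset.sum_comm]
  push_cast
  simp only [← Finset.sum_add_distrib]
  refine Finset.sum_congr rfl fun a ha => Finset.sum_congr rfl fun b hb => ?_
  rw [card_isCycleResidue hp2 he (Finset.mem_Icc.1 hb).1 (Finset.mem_Icc.1 ha).1,
    mul_comm (b ^ n) (a ^ n)]

/-! ### Totient sums over divisors of p - 1 -/

/-- The indicator keeps the range of d independent of k, so that sums can be exchanged. -/
theorem Nat.gcd_eq_sum_divisors_totient {m : ℕ} (hm : m ≠ 0) (k : ℕ) :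
    (m.gcd k : ℤ) = ∑ d ∈ m.divisors, (d.totient : ℤ) * if d ∣ k then 1 else 0 := by
  conv_lhs => rw [← Nat.sum_totient (m.gcd k)]
  simp_rw [mul_ite, mul_one, mul_zero]
  rw [← Finset.sum_filter, Nat.cast_sum]
  refine Finset.sum_congr ?_ fun _ _ => rfl
  ext d
  simp [Nat.dvd_gcd_iff, hm]

theorem ZMod.sum_range_natCast {d : ℕ} [NeZero d] {M : Type*} [AddCommMonoid M] (g : ZMod d → M) :
    ∑ i ∈ Finset.range d, g i = ∑ u : ZMod d, g u := by
  refine Finset.sum_nbij' (fun i => (i : ZMod d)) ZMod.val (by simp)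
    (by simp [ZMod.val_lt]) ?_ (by simp) (by simp)
  intro i hi
  exact ZMod.val_cast_of_lt (Finset.mem_range.1 hi)

/-- A sum over `1, …, d * c` of a function periodic modulo `d`. -/
theorem ZMod.sum_Icc_natCast {d : ℕ} [NeZero d] (g : ZMod d → ℤ) (c : ℕ) :
    ∑ x ∈ Finset.Icc 1 (d * c), g x = c * ∑ u : ZMod d, g u := by
  have h1 : ∑ x ∈ Finset.Icc 1 (d * c), g x = ∑ i ∈ Finset.range (d * c), g ((i : ZMod d) + 1) := by
    rw [← Finset.Ico_succ_right_eq_Icc, Order.succ_eq_add_one, Finset.range_eq_Ico,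
      ← Finset.sum_Ico_add' (fun x : ℕ => g x) 0 (d * c) 1]
    push_cast
    rfl
  rw [h1]
  clear h1
  induction c with
  | zero => simp
  | succ c ih =>
    rw [Nat.mul_succ, Finset.sum_range_add, ih]
    have h2 : ∀ i : ℕ, g (((d * c + i : ℕ) : ZMod d) + 1) = g ((i : ZMod d) + 1) := by simp
    simp_rw [h2]
    rw [ZMod.sum_range_natCast (fun u => g (u + 1)),
      Fintype.sum_equiv (Equiv.addRight (1 : ZMod d)) (fun u => g (u + 1)) g (fun _ => rfl)]
    push_cast
    ring

theorem ZMod.card_filter_range {d : ℕ} [NeZero d] (P : ZMod d → Prop) [DecidablePred P] :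
    ((Finset.range d).filter fun z : ℕ => P z).card = (Finset.univ.filter P).card := by
  rw [Finset.card_filter, Finset.card_filter,
    ZMod.sum_range_natCast fun u => if P u then 1 else 0]

theorem numPowSubOne_eq_card {d : ℕ} [NeZero d] (n : ℕ) :
    numPowSubOne n d = (Finset.univ.filter fun z : ZMod d => z ^ n = 1).card := by
  rw [← ZMod.card_filter_range, numPowSubOne]
  congr 1
  refine Finset.filter_congr fun z _ => ?_
  rw [← ZMod.intCast_eq_intCast_iff]
  push_cast
  rw [sub_eq_zero]

open Classical in
theorem numCoprimeMulPowAddOne_eq_card {d : ℕ} [NeZero d] (n : ℕ) :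
    numCoprimeMulPowAddOne n d =
      (Finset.univ.filter fun z : ZMod d => IsUnit z ∧ n * (z ^ n + 1) = 0).card := by
  rw [← ZMod.card_filter_range, numCoprimeMulPowAddOne]
  congr 1
  refine Finset.filter_congr fun z _ => ?_
  rw [ZMod.isUnit_iff_coprime, ← ZMod.natCast_eq_natCast_iff]
  push_cast
  rfl

open Classical in
-- The equation forces v to be a unit, as n ≠ 0; for such v, the bijection u ↦ uv leads to the roots
-- of z^n = 1.
theorem ZMod.sum_sum_mul_pow_eq_one {d : ℕ} [NeZero d] {n : ℕ} (hn : n ≠ 0) (H : ZMod d → Prop) :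
    ∑ u : ZMod d, ∑ v : ZMod d, (if u ^ n * v ^ n = 1 ∧ H v then (1 : ℤ) else 0) =
      (Finset.univ.filter fun v : ZMod d => IsUnit v ∧ H v).card * numPowSubOne n d := by
  rw [Finset.sum_comm, Finset.card_filter, Nat.cast_sum, Finset.sum_mul]
  refine Finset.sum_congr rfl fun v _ => ?_
  by_cases hv : IsUnit v
  · by_cases hH : H v
    · obtain ⟨w, rfl⟩ := hv
      simp only [hH, and_true, Units.isUnit, if_true, Nat.cast_one, one_mul]
      rw [numPowSubOne_eq_card, Finset.card_filter, Nat.cast_sum]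
      simp_rw [← mul_pow]
      exact Fintype.sum_equiv (Units.mulRight w) _ _ fun u => by simp
    · simp [hH]
  · have h1 : ∀ u : ZMod d, ¬ u ^ n * v ^ n = 1 := fun u h => hv
      ((isUnit_pow_iff hn).1 (IsUnit.of_mul_eq_one _ (mul_comm (u ^ n) _ ▸ h)))
    simp [h1, hv]

theorem dvd_pow_mul_pow_sub_one_iff {d x y n : ℕ} (hx : 1 ≤ x) (hy : 1 ≤ y) :
    d ∣ x ^ n * y ^ n - 1 ↔ (x : ZMod d) ^ n * (y : ZMod d) ^ n = 1 := by
  have h : 1 ≤ x ^ n * y ^ n := Nat.mul_pos (pow_pos hx n) (pow_pos hy n)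
  rw [← ZMod.natCast_eq_zero_iff, Nat.cast_sub h, sub_eq_zero]
  push_cast
  rfl

open Classical in
/-- Summing the totients of the divisors `d` of `gcd (q, x ^ n * y ^ n - 1)` subject to a condition
`H d y` that depends only on `y` modulo `d`. -/
theorem sum_sum_sum_divisors {q n : ℕ} (hq : q ≠ 0) (hn : n ≠ 0) (H : (d : ℕ) → ZMod d → Prop) :
    ∑ x ∈ Finset.Icc 1 q, ∑ y ∈ Finset.Icc 1 q, ∑ d ∈ q.divisors,
      (d.totient : ℤ) * (if d ∣ x ^ n * y ^ n - 1 ∧ H d y then 1 else 0) =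
    ∑ d ∈ q.divisors, (d.totient : ℤ) * ((q / d : ℕ) : ℤ) ^ 2 *
      (((Finset.range d).filter fun v : ℕ => v.Coprime d ∧ H d v).card : ℤ) * numPowSubOne n d := by
  simp_rw [Finset.sum_comm (s := Finset.Icc 1 q) (t := q.divisors)]
  refine Finset.sum_congr rfl fun d hd => ?_
  have hdq := Nat.dvd_of_mem_divisors hd
  have : NeZero d := ⟨fun h => hq (Nat.eq_zero_of_zero_dvd (h ▸ hdq))⟩
  set F : ZMod d → ZMod d → ℤ := fun u v => if u ^ n * v ^ n = 1 ∧ H d v then 1 else 0 with hF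
  have h1 : ∀ x ∈ Finset.Icc 1 q, ∀ y ∈ Finset.Icc 1 q,
      (d.totient : ℤ) * (if d ∣ x ^ n * y ^ n - 1 ∧ H d y then 1 else 0) =
      (d.totient : ℤ) * F x y := by
    intro x hx y hy
    simp only [hF, dvd_pow_mul_pow_sub_one_iff (Finset.mem_Icc.1 hx).1 (Finset.mem_Icc.1 hy).1]
  rw [Finset.sum_congr rfl fun x hx => Finset.sum_congr rfl (h1 x hx)]
  simp_rw [← Finset.mul_sum]
  -- The range 1, …, dc covers c = q/d periods in each variable, whence the square.
  obtain ⟨c, rfl⟩ := hdq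
  have hcard : ((Finset.range d).filter fun v : ℕ => v.Coprime d ∧ H d v).card =
      (Finset.univ.filter fun v : ZMod d => IsUnit v ∧ H d v).card := by
    rw [← ZMod.card_filter_range]
    congr 1
    exact Finset.filter_congr fun v _ => by rw [ZMod.isUnit_iff_coprime]
  rw [Nat.mul_div_cancel_left _ (NeZero.pos d), hcard]
  rw [Finset.sum_congr rfl fun (x : ℕ) _ => ZMod.sum_Icc_natCast (F x) c, ← Finset.mul_sum,
    ZMod.sum_Icc_natCast (fun u => ∑ v, F u v),
    ZMod.sum_sum_mul_pow_eq_one hn]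
  ring

theorem Nat.card_range_filter_coprime (d : ℕ) :
    ((Finset.range d).filter fun v : ℕ => v.Coprime d).card = d.totient := by
  rw [Nat.totient_eq_card_coprime]
  simp_rw [Nat.coprime_comm]

open Classical in
theorem sum_sum_gcd_pow_mul_pow_sub_one {q n : ℕ} (hq : q ≠ 0) (hn : n ≠ 0) :
    ∑ x ∈ Finset.Icc 1 q, ∑ y ∈ Finset.Icc 1 q, (q.gcd (x ^ n * y ^ n - 1) : ℤ) =
      ∑ d ∈ q.divisors, (d.totient : ℤ) ^ 2 * ((q / d : ℕ) : ℤ) ^ 2 * numPowSubOne n d := by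
  have h := sum_sum_sum_divisors hq hn fun _ _ => True
  simp only [and_true, Nat.card_range_filter_coprime] at h
  simp_rw [Nat.gcd_eq_sum_divisors_totient hq]
  refine Eq.trans ?_ (h.trans (Finset.sum_congr rfl fun d _ => by ring))
  congr!

open Classical in
theorem sum_sum_gcd_mul_pow_add_one {q n : ℕ} (hq : q ≠ 0) (hn : n ≠ 0) :
    ∑ x ∈ Finset.Icc 1 q, ∑ y ∈ Finset.Icc 1 q,
      (q.gcd ((n * (y ^ n + 1)).gcd (x ^ n * y ^ n - 1)) : ℤ) =
      ∑ d ∈ q.divisors, (d.totient : ℤ) * ((q / d : ℕ) : ℤ) ^ 2 *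
        numCoprimeMulPowAddOne n d * numPowSubOne n d := by
  have h := sum_sum_sum_divisors hq hn fun d v => (n : ZMod d) * (v ^ n + 1) = 0
  have h1 : ∀ d y : ℕ, (n : ZMod d) * ((y : ZMod d) ^ n + 1) = 0 ↔ d ∣ n * (y ^ n + 1) :=
    fun d y => by rw [← ZMod.natCast_eq_zero_iff]; push_cast; rfl
  simp_rw [Nat.gcd_eq_sum_divisors_totient hq, Nat.dvd_gcd_iff, and_comm (b := _ ∣ _ - 1), ← h1]
  refine Eq.trans ?_ (h.trans (Finset.sum_congr rfl fun d _ => ?_))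
  · congr!
  · congr 3
    rw [numCoprimeMulPowAddOne]
    congr 1
    ext z
    simp only [Finset.mem_filter, h1, Nat.modEq_zero_iff_dvd]

open Classical in
theorem sum_sum_gcd_gcd_const {q n : ℕ} (hq : q ≠ 0) (hn : n ≠ 0) (c : ℕ) :
    ∑ x ∈ Finset.Icc 1 q, ∑ y ∈ Finset.Icc 1 q, (q.gcd (c.gcd (x ^ n * y ^ n - 1)) : ℤ) =
      ∑ d ∈ q.divisors with d ∣ c,
        (d.totient : ℤ) ^ 2 * ((q / d : ℕ) : ℤ) ^ 2 * numPowSubOne n d := by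
  have h := sum_sum_sum_divisors hq hn fun d _ => d ∣ c
  simp_rw [Nat.gcd_eq_sum_divisors_totient hq, Nat.dvd_gcd_iff, and_comm (b := _ ∣ _ - 1)]
  rw [Finset.sum_filter]
  refine Eq.trans ?_ (h.trans (Finset.sum_congr rfl fun d _ => ?_))
  · congr!
  · by_cases hd : d ∣ c
    · simp only [hd, and_true, Nat.card_range_filter_coprime, if_true]
      ring
    · simp [hd]

/-- Divisors of n are divisors of 2n, so the difference keeps exactly those d dividing 2n but not n.
-/
theorem sum_sum_gcd_two_mul_sub_gcd {q n : ℕ} (hq : q ≠ 0) (hn : n ≠ 0) :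
    ∑ x ∈ Finset.Icc 1 q, ∑ y ∈ Finset.Icc 1 q,
      ((q.gcd ((2 * n).gcd (x ^ n * y ^ n - 1)) : ℤ) - (q.gcd (n.gcd (x ^ n * y ^ n - 1)) : ℤ)) =
      ∑ d ∈ (q.gcd (2 * n)).divisors with ¬ d ∣ q.gcd n,
        (d.totient : ℤ) ^ 2 * ((q / d : ℕ) : ℤ) ^ 2 * numPowSubOne n d := by
  simp_rw [Finset.sum_sub_distrib]
  rw [sum_sum_gcd_gcd_const hq hn, sum_sum_gcd_gcd_const hq hn, sub_eq_iff_eq_add,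
    ← Finset.sum_union]
  · refine Finset.sum_congr ?_ fun _ _ => rfl
    ext d
    have h : d ∣ n → d ∣ 2 * n := fun h => h.mul_left 2
    simp only [Finset.mem_filter, Finset.mem_union, Nat.mem_divisors, Nat.dvd_gcd_iff, ne_eq,
      Nat.gcd_eq_zero_iff, hq, false_and, not_false_eq_true, and_true]
    tauto
  · refine Finset.disjoint_left.2 fun d h h' => (Finset.mem_filter.1 h).2 ?_
    obtain ⟨h1, h2⟩ := Finset.mem_filter.1 h'
    exact Nat.dvd_gcd (Nat.dvd_of_mem_divisors h1) h2

/-! ### The case n = 1 and conclusion -/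

theorem numPowSubOne_one {d : ℕ} (hd : d ≠ 0) : numPowSubOne 1 d = 1 := by
  have : NeZero d := ⟨hd⟩
  rw [numPowSubOne_eq_card, Finset.card_eq_one]
  exact ⟨1, by ext; simp⟩

theorem numCoprimeMulPowAddOne_one {d : ℕ} (hd : d ≠ 0) : numCoprimeMulPowAddOne 1 d = 1 := by
  classical
  have : NeZero d := ⟨hd⟩
  rw [numCoprimeMulPowAddOne_eq_card, Finset.card_eq_one]
  refine ⟨-1, ?_⟩
  ext z
  simp only [Nat.cast_one, pow_one, one_mul, Finset.mem_filter, Finset.mem_univ, true_and,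
    Finset.mem_singleton, ← eq_neg_iff_add_eq_zero]
  exact ⟨fun h => h.2, fun h => ⟨h ▸ isUnit_one.neg, h⟩⟩

theorem selfPowerTwoCycles_eq (p e : ℕ) : selfPowerTwoCycles p e = twoCycles p 1 e := by
  simp only [selfPowerTwoCycles, twoCycles, pow_one]

theorem card_twoCycles_eq_sum_divisors {p : ℕ} (hp : p.Prime) (hp2 : p ≠ 2) {e n : ℕ} (he : 1 ≤ e)
    (hn : ¬ p ∣ n) :
    ((twoCycles p n e).card : ℤ) =
      (∑ d ∈ (p - 1).divisors,
        (Nat.totient d : ℤ) ^ 2 * (((p - 1) / d : ℕ) : ℤ) ^ 2 * (numPowSubOne n d : ℤ))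
      + (∑ d ∈ (p - 1).divisors,
        (Nat.totient d : ℤ) * (((p - 1) / d : ℕ) : ℤ) ^ 2
          * (numCoprimeMulPowAddOne n d : ℤ) * (numPowSubOne n d : ℤ)
          * ((p : ℤ) ^ (e / 2) - 1))
      + (∑ d ∈ (Nat.gcd (p - 1) (2 * n)).divisors with ¬ d ∣ Nat.gcd (p - 1) n,
        (Nat.totient d : ℤ) ^ 2 * (((p - 1) / d : ℕ) : ℤ) ^ 2 * (numPowSubOne n d : ℤ)
          * ((p : ℤ) ^ (e / 3 + (e + 1) / 3) - (p : ℤ) ^ (e / 2))) := by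
  have hq : p - 1 ≠ 0 := (Nat.sub_pos_of_lt hp.one_lt).ne'
  have hn0 : n ≠ 0 := fun h => hn (h ▸ dvd_zero _)
  rw [card_twoCycles_eq_sum_gcd hp hp2 he hn]
  simp_rw [← Finset.sum_mul]
  rw [sum_sum_gcd_pow_mul_pow_sub_one hq hn0, sum_sum_gcd_mul_pow_add_one hq hn0,
    sum_sum_gcd_two_mul_sub_gcd hq hn0]

theorem theorem4p5 (p : ℕ) (hp : p.Prime) (hp2 : p ≠ 2) (e : ℕ) (he : 1 ≤ e) :
    (∀ n : ℕ, ¬ p ∣ n →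
      ((twoCycles p n e).card : ℤ) =
          (∑ x₀ ∈ Finset.Icc 1 (p - 1), ∑ y₀ ∈ Finset.Icc 1 (p - 1),
            (Nat.gcd (p - 1) (x₀ ^ n * y₀ ^ n - 1) : ℤ))
          + (∑ x₀ ∈ Finset.Icc 1 (p - 1), ∑ y₀ ∈ Finset.Icc 1 (p - 1),
            (Nat.gcd (p - 1) (Nat.gcd (n * (y₀ ^ n + 1)) (x₀ ^ n * y₀ ^ n - 1)) : ℤ)
              * ((p : ℤ) ^ (e / 2) - 1))
          + (∑ x₀ ∈ Finset.Icc 1 (p - 1), ∑ y₀ ∈ Finset.Icc 1 (p - 1),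
            ((Nat.gcd (p - 1) (Nat.gcd (2 * n) (x₀ ^ n * y₀ ^ n - 1)) : ℤ)
              - (Nat.gcd (p - 1) (Nat.gcd n (x₀ ^ n * y₀ ^ n - 1)) : ℤ))
              * ((p : ℤ) ^ (e / 3 + (e + 1) / 3) - (p : ℤ) ^ (e / 2)))
      ∧
      ((twoCycles p n e).card : ℤ) =
          (∑ d ∈ (p - 1).divisors,
            (Nat.totient d : ℤ) ^ 2 * (((p - 1) / d : ℕ) : ℤ) ^ 2 * (numPowSubOne n d : ℤ))
          + (∑ d ∈ (p - 1).divisors,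
            (Nat.totient d : ℤ) * (((p - 1) / d : ℕ) : ℤ) ^ 2
              * (numCoprimeMulPowAddOne n d : ℤ) * (numPowSubOne n d : ℤ)
              * ((p : ℤ) ^ (e / 2) - 1))
          + (∑ d ∈ (Nat.gcd (p - 1) (2 * n)).divisors with ¬ d ∣ Nat.gcd (p - 1) n,
            (Nat.totient d : ℤ) ^ 2 * (((p - 1) / d : ℕ) : ℤ) ^ 2 * (numPowSubOne n d : ℤ)
              * ((p : ℤ) ^ (e / 3 + (e + 1) / 3) - (p : ℤ) ^ (e / 2))))
    ∧
    (((selfPowerTwoCycles p e).card : ℤ) =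
          (∑ x₀ ∈ Finset.Icc 1 (p - 1), ∑ y₀ ∈ Finset.Icc 1 (p - 1),
            (Nat.gcd (p - 1) (x₀ * y₀ - 1) : ℤ))
          + (∑ x₀ ∈ Finset.Icc 1 (p - 1), ∑ y₀ ∈ Finset.Icc 1 (p - 1),
            (Nat.gcd (p - 1) (Nat.gcd (y₀ + 1) (x₀ * y₀ - 1)) : ℤ)
              * ((p : ℤ) ^ (e / 2) - 1))
          + (∑ x₀ ∈ Finset.Icc 1 (p - 1), ∑ y₀ ∈ Finset.Icc 1 (p - 1),
            ((Nat.gcd 2 (x₀ * y₀ - 1) : ℤ) - 1)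
              * ((p : ℤ) ^ (e / 3 + (e + 1) / 3) - (p : ℤ) ^ (e / 2)))
      ∧
      ((selfPowerTwoCycles p e).card : ℤ) =
          (∑ d ∈ (p - 1).divisors, (Nat.totient d : ℤ) ^ 2 * (((p - 1) / d : ℕ) : ℤ) ^ 2)
          + (∑ d ∈ (p - 1).divisors,
            (Nat.totient d : ℤ) * (((p - 1) / d : ℕ) : ℤ) ^ 2 * ((p : ℤ) ^ (e / 2) - 1))
          + (((p - 1) / 2 : ℕ) : ℤ) ^ 2
              * ((p : ℤ) ^ (e / 3 + (e + 1) / 3) - (p : ℤ) ^ (e / 2))) := by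

  have h1 : ¬ p ∣ 1 := fun h => hp.one_lt.ne' (Nat.dvd_one.1 h)
  have h2 : 2 ∣ p - 1 := (hp.even_sub_one hp2).two_dvd
  refine ⟨fun n hn => ⟨card_twoCycles_eq_sum_gcd hp hp2 he hn,
    card_twoCycles_eq_sum_divisors hp hp2 he hn⟩, ?_, ?_⟩
  -- As p - 1 is even, it drops out of the gcd.
  · have h3 : ∀ m, (p - 1).gcd (Nat.gcd 2 m) = Nat.gcd 2 m := fun m =>
      Nat.gcd_eq_right ((Nat.gcd_dvd_left _ _).trans h2)
    rw [selfPowerTwoCycles_eq, card_twoCycles_eq_sum_gcd hp hp2 he h1]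
    simp only [pow_one, one_mul, mul_one, h3, Nat.gcd_one_left, Nat.gcd_one_right, Nat.cast_one]
  · rw [selfPowerTwoCycles_eq, card_twoCycles_eq_sum_divisors hp hp2 he h1]
    have h4 : {d ∈ (Nat.gcd (p - 1) (2 * 1)).divisors | ¬ d ∣ Nat.gcd (p - 1) 1} = {2} := by
      rw [mul_one, Nat.gcd_eq_right h2, Nat.gcd_one_right]
      decide
    have h5 : ∀ d ∈ (p - 1).divisors, d ≠ 0 := fun d hd => (Nat.pos_of_mem_divisors hd).ne'
    rw [h4, Finset.sum_singleton, numPowSubOne_one two_ne_zero, Nat.totient_two]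
    congr 1
    · congr 1
      · exact Finset.sum_congr rfl fun d hd => by simp [numPowSubOne_one (h5 d hd)]
      · exact Finset.sum_congr rfl fun d hd => by
          simp [numPowSubOne_one (h5 d hd), numCoprimeMulPowAddOne_one (h5 d hd)]
    · simp
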